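/- Let $\mathbb K$ be an algebraically closed field of characteristic $p>0$, let $G$ be a connected reductive algebraic group over $\mathbb K$ with maximal torus $T$ and Borel subgroup $B\supseteq T$, let $X=X(T)$ be the character group of $T$, and put $\mathfrak g=\mathrm{Lie}(G)$, $\mathfrak h=\mathrm{Lie}(T)$, $\mathfrak b=\mathrm{Lie}(B)$. Let $R\subset X$ be the set of roots, $R^+$ the positive roots (those with $\mathfrak g_\alpha\subseteq\mathfrak b$) and $\Pi$ the simple roots. Fix a basis $\{e_\alpha,h_i\mid \alpha\in R,\ 1\le i\le d\}$ of $\mathfrak g$ with $e_\alpha\in\mathfrak g_\alpha$ and $h_1,\dots,h_d$ a basis of $\mathfrak h$ with $h_i^{[p]}=h_i$, and put $h_\alpha=[e_\alpha,e_{-\alpha}]\in\mathfrak h$. Let $I\subseteq\Pi$ and let $\chi\in\mathfrak g^*$ be in standard Levi form for $I$: $\chi(\mathfrak b)=0$ and, for $\alpha\in R^+$, $\chi(e_{-\alpha})=1$ if $\alpha\in I$ and $\chi(e_{-\alpha})=0$ otherwise. Put $U_\chi=U(\mathfrak g)/\langle e_\alpha^p-\chi(e_\alpha)^p\mid\alpha\in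 R\rangle$, graded by $X/\mathbb ZI$ with $e_\alpha$ in degree $\alpha+\mathbb ZI$ and $\mathfrak h$ in degree $0$, and $U^0=U(\mathfrak h)$. For $\mu\in X$ let $d\mu\in\mathfrak h^*$ be its differential and $\widetilde\mu:U^0\to U^0$ the algebra homomorphism with $\widetilde\mu(h)=h+d\mu(h)$ for $h\in\mathfrak h$. Let $A$ be a commutative Noetherian $\mathbb K$-algebra. For a homomorphism of $\mathbb K$-algebras $\pi:U^0\to A$, let $\mathscr C_{A,\pi}$ be the following category. Its objects are $U_\chi\otimes A$-modules $M$ (written with $U_\chi$ acting on the left and $A$ on the right) with a grading $M=\bigoplus_{\lambda+\mathbb ZI\in X/\mathbb ZI}M_{\lambda+\mathbb ZI}$ by $\mathbb K$-subspaces such that (A) $M_{\lambda+\mathbb ZI}A\subseteq M_{\lambda+\mathbb ZI}$; (B) only finitely many $M_{\lambda+\mathbb ZI}$ are nonzero and each is a finitely generated $A$-module; (C) $(U_\chi)_{\sigma+\mathbb ZI}M_{\lambda+\mathbb ZI}\subseteq M_{\sigma+\lambda+\mathbb ZI}$; (D) each $M_{\lambda+\mathbb ZI}$ has a decomposition $M_{\lambda+\mathbb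 ZI}=\bigoplus_{d\mu:\ \mu\in\lambda+\mathbb ZI+pX}M_{\lambda+\mathbb ZI}^{d\mu}$, indexed by the distinct differentials $d\mu$, such that for $m\in M_{\lambda+\mathbb ZI}^{d\mu}$ one has $sm=m\,\pi(\widetilde\mu(s))$ for all $s\in U^0$, $e_\alpha m\in M_{\lambda+\alpha+\mathbb ZI}^{d(\mu+\alpha)}$ for all $\alpha\in R$, and $ma\in M_{\lambda+\mathbb ZI}^{d\mu}$ for all $a\in A$. Morphisms $M\to N$ are the homomorphisms of $U_\chi\otimes A$-modules that send $M_{\lambda+\mathbb ZI}^{d\mu}$ to $N_{\lambda+\mathbb ZI}^{d\mu}$ for all $\lambda+\mathbb ZI$ and all $\mu\in\lambda+\mathbb ZI+pX$. Fix $\pi:U^0\to A$, write $\mathscr C_A=\mathscr C_{A,\pi}$, and let $\mathscr C_A^\circ=\mathscr C_{A,\pi^\circ}$, where $\pi^\circ:U^0\to\mathbb K\to A$ is the structure map with $\pi^\circ(h)=0$ for all $h\in\mathfrak h$. **Proposition.** If $\pi(h_\alpha)=0$ for all $\alpha\in R$, there is an equivalence of categories $\Theta_A:\mathscr C_A^\circ\to\mathscr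 C_A$ such that, for every object $M$ of $\mathscr C_A^\circ$, the object $\Theta_A(M)$ is equal to $M$ as an $A$-module, with the same grading and the same summands $M_{\lambda+\mathbb ZI}^{d\mu}$; each $e_\alpha$ ($\alpha\in R$) acts on $\Theta_A(M)$ as it does on $M$; each $s\in U^0$ acts on $m\in\Theta_A(M)_{\lambda+\mathbb ZI}^{d\mu}=M_{\lambda+\mathbb ZI}^{d\mu}$ (for $\mu\in\lambda+\mathbb ZI+pX$) by $s\cdot m=m\,\pi(\widetilde\mu(s))$; and $\Theta_A(f)=f$ as a map for every morphism $f$ of $\mathscr C_A^\circ$. -/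

import Mathlib

open CategoryTheory

universe u v w

attribute [local instance 100] LieRing.ofAssociativeRing

noncomputable section

namespace ReducedEnveloping

/-! ## Linear algebraic groups, as Zariski closed subgroups of `GL_n(K)` -/

section AlgebraicGroups

variable {n : ℕ} {K : Type u} [Field K]

/-- Polynomials in the entries of a matrix `g` (left summand) and of `g⁻¹` (right summand).
As functions on `GL_n(K)` they are exactly the regular functions. -/
abbrev Coord (n : ℕ) (K : Type u) [Field K] : Type u :=
  MvPolynomial ((Fin n × Fin n) ⊕ (Fin n × Fin n)) K

/-- The value of a regular function at `g`. -/
def evalAt (g : GL (Fin n) K) : Coord n K →ₐ[K] K :=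
  MvPolynomial.aeval (Sum.elim
    (fun a => (g : Matrix (Fin n) (Fin n) K) a.1 a.2)
    (fun a => ((g⁻¹ : GL (Fin n) K) : Matrix (Fin n) (Fin n) K) a.1 a.2))

/-- The Zariski topology on `GL_n(K)`, generated by the principal open sets. -/
@[reducible] def zariski (n : ℕ) (K : Type u) [Field K] : TopologicalSpace (GL (Fin n) K) :=
  TopologicalSpace.generateFrom {U | ∃ f : Coord n K, U = {g | evalAt g f ≠ 0}}

/-- Zariski closed subgroups of `GL_n(K)`, i.e. linear algebraic groups. -/
def IsClosedSubgroup (H : Subgroup (GL (Fin n) K)) : Prop :=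
  @IsClosed _ (zariski n K) (H : Set (GL (Fin n) K))

/-- Connectedness in the Zariski topology. -/
def IsConnectedSubgroup (H : Subgroup (GL (Fin n) K)) : Prop :=
  @IsConnected _ (zariski n K) (H : Set (GL (Fin n) K))

/-- A torus: a closed connected diagonalizable subgroup. -/
def IsTorus (H : Subgroup (GL (Fin n) K)) : Prop :=
  IsClosedSubgroup H ∧ IsConnectedSubgroup H ∧
    ∃ q : GL (Fin n) K, ∀ t ∈ H, ((q * t * q⁻¹ : GL (Fin n) K) : Matrix (Fin n) (Fin n) K).IsDiag

def IsMaximalTorus (G T : Subgroup (GL (Fin n) K)) : Prop :=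
  Maximal (fun H => H ≤ G ∧ IsTorus H) T

/-- A Borel subgroup: a maximal closed connected solvable subgroup. -/
def IsBorel (G B : Subgroup (GL (Fin n) K)) : Prop :=
  Maximal (fun H : Subgroup (GL (Fin n) K) =>
    H ≤ G ∧ IsClosedSubgroup H ∧ IsConnectedSubgroup H ∧ Group.IsSolvable H) B

/-- A connected reductive group: closed, connected, and every closed connected normal
unipotent subgroup is trivial. -/
def IsConnectedReductive (G : Subgroup (GL (Fin n) K)) : Prop :=
  IsClosedSubgroup G ∧ IsConnectedSubgroup G ∧
    ∀ N : Subgroup (GL (Fin n) K), N ≤ G → IsClosedSubgroup N → IsConnectedSubgroup N →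
      (N.subgroupOf G).Normal →
      (∀ g ∈ N, IsNilpotent ((g : Matrix (Fin n) (Fin n) K) - 1)) → N = ⊥

/-- The left invariant derivation of the ring of regular functions given by a matrix `x`; its
value at `g` is the derivative in the direction `g x`. It sends the coordinate matrix `Z` to `Z x`
and `Z⁻¹` to `- x Z⁻¹`. -/
def leftDer (x : Matrix (Fin n) (Fin n) K) : Derivation K (Coord n K) (Coord n K) :=
  MvPolynomial.mkDerivation K (Sum.elim
    (fun a => ∑ k, MvPolynomial.X (Sum.inl (a.1, k)) * MvPolynomial.C (x k a.2))
    (fun a => - ∑ k, MvPolynomial.C (x a.1 k) * MvPolynomial.X (Sum.inr (k, a.2))))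

lemma leftDer_inl (x : Matrix (Fin n) (Fin n) K) (a : Fin n × Fin n) :
    leftDer x (MvPolynomial.X (Sum.inl a)) =
      ∑ k, MvPolynomial.X (Sum.inl (a.1, k)) * MvPolynomial.C (x k a.2) := by
  simp [leftDer, MvPolynomial.mkDerivation_X]

lemma leftDer_inr (x : Matrix (Fin n) (Fin n) K) (a : Fin n × Fin n) :
    leftDer x (MvPolynomial.X (Sum.inr a)) =
      - ∑ k, MvPolynomial.C (x a.1 k) * MvPolynomial.X (Sum.inr (k, a.2)) := by
  simp [leftDer, MvPolynomial.mkDerivation_X]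

lemma leftDer_C (x : Matrix (Fin n) (Fin n) K) (c : K) :
    leftDer x (MvPolynomial.C c) = 0 := by
  simp [leftDer]

lemma leftDer_C_mul (x : Matrix (Fin n) (Fin n) K) (c : K) (f : Coord n K) :
    leftDer x (MvPolynomial.C c * f) = MvPolynomial.C c * leftDer x f := by
  simp [Derivation.leibniz]

lemma leftDer_add (x y : Matrix (Fin n) (Fin n) K) :
    leftDer (x + y) = leftDer x + leftDer y := by
  apply MvPolynomial.derivation_ext
  rintro (a | a)
  · simp [leftDer_inl, mul_add, Finset.sum_add_distrib]
  · simp [leftDer_inr, add_mul, Finset.sum_add_distrib, add_comm]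

lemma leftDer_smul (c : K) (x : Matrix (Fin n) (Fin n) K) :
    leftDer (c • x) = c • leftDer x := by
  apply MvPolynomial.derivation_ext
  rintro (a | a)
  · simp only [leftDer_inl, Derivation.smul_apply, MvPolynomial.smul_eq_C_mul, Finset.mul_sum,
      Matrix.smul_apply, smul_eq_mul, map_mul]
    exact Finset.sum_congr rfl fun k _ => by ring
  · simp only [leftDer_inr, Derivation.smul_apply, MvPolynomial.smul_eq_C_mul, Finset.mul_sum,
      Matrix.smul_apply, smul_eq_mul, map_mul, mul_neg]
    exact congrArg _ (Finset.sum_congr rfl fun k _ => by ring)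

lemma leftDer_lie (x y : Matrix (Fin n) (Fin n) K) :
    leftDer ⁅x, y⁆ = ⁅leftDer x, leftDer y⁆ := by
  apply MvPolynomial.derivation_ext
  rintro (a | a)
  · have key : ∀ x y : Matrix (Fin n) (Fin n) K,
        leftDer x (leftDer y (MvPolynomial.X (Sum.inl a))) =
        ∑ k, MvPolynomial.X (Sum.inl (a.1, k)) * MvPolynomial.C ((x * y) k a.2) := by
      intro x y
      rw [leftDer_inl, map_sum]
      simp_rw [mul_comm _ (MvPolynomial.C _), leftDer_C_mul, leftDer_inl, Finset.mul_sum]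
      rw [Finset.sum_comm]
      refine Finset.sum_congr rfl fun k _ => ?_
      rw [Matrix.mul_apply, map_sum, Finset.sum_mul]
      refine Finset.sum_congr rfl fun l _ => ?_
      simp only [map_mul]
      ring
    rw [Derivation.commutator_apply, key, key, leftDer_inl, ← Finset.sum_sub_distrib]
    refine Finset.sum_congr rfl fun k _ => ?_
    rw [Ring.lie_def, Matrix.sub_apply, map_sub, mul_sub]
  · have key : ∀ x y : Matrix (Fin n) (Fin n) K,
        leftDer x (leftDer y (MvPolynomial.X (Sum.inr a))) =
        ∑ k, MvPolynomial.C ((y * x) a.1 k) * MvPolynomial.X (Sum.inr (k, a.2)) := by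
      intro x y
      rw [leftDer_inr, map_neg, map_sum]
      simp_rw [leftDer_C_mul, leftDer_inr, mul_neg, Finset.sum_neg_distrib, neg_neg,
        Finset.mul_sum]
      rw [Finset.sum_comm]
      refine Finset.sum_congr rfl fun k _ => ?_
      rw [Matrix.mul_apply, map_sum, Finset.sum_mul]
      refine Finset.sum_congr rfl fun l _ => ?_
      simp only [map_mul]
      ring
    rw [Derivation.commutator_apply, key, key, leftDer_inr, ← Finset.sum_sub_distrib,
      ← Finset.sum_neg_distrib]
    refine Finset.sum_congr rfl fun k _ => ?_
    rw [Ring.lie_def, Matrix.sub_apply, map_sub]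
    ring

/-- Left translation of regular functions: `(leftTrans g f)(t) = f (g t)`. -/
def leftTrans (g : GL (Fin n) K) : Coord n K →ₐ[K] Coord n K :=
  MvPolynomial.aeval (Sum.elim
    (fun a => ∑ k, MvPolynomial.C ((g : Matrix (Fin n) (Fin n) K) a.1 k) *
      MvPolynomial.X (Sum.inl (k, a.2)))
    (fun a => ∑ k, MvPolynomial.C (((g⁻¹ : GL (Fin n) K) : Matrix (Fin n) (Fin n) K) k a.2) *
      MvPolynomial.X (Sum.inr (a.1, k))))

lemma evalAt_leftTrans (g t : GL (Fin n) K) (f : Coord n K) :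
    evalAt t (leftTrans g f) = evalAt (g * t) f := by
  have : (evalAt t).comp (leftTrans g) = evalAt (g * t) := by
    apply MvPolynomial.algHom_ext
    rintro (a | a)
    · simp [evalAt, leftTrans, Matrix.mul_apply]
    · simp only [evalAt, leftTrans, AlgHom.comp_apply, MvPolynomial.aeval_X, Sum.elim_inr, map_sum,
        map_mul, MvPolynomial.algHom_C, mul_inv_rev, Units.val_mul, Matrix.mul_apply]
      exact Finset.sum_congr rfl fun k _ => mul_comm _ _
  exact congrArg (fun φ : Coord n K →ₐ[K] K => φ f) this

lemma leftDer_leftTrans (x : Matrix (Fin n) (Fin n) K) (g : GL (Fin n) K) (f : Coord n K) :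
    leftDer x (leftTrans g f) = leftTrans g (leftDer x f) := by
  induction f using MvPolynomial.induction_on with
  | C c => simp [leftTrans]
  | add f₁ f₂ h₁ h₂ => simp [h₁, h₂]
  | mul_X f a h =>
    have hX : leftDer x (leftTrans g (MvPolynomial.X a)) =
        leftTrans g (leftDer x (MvPolynomial.X a)) := by
      rcases a with a | a
      · rw [leftDer_inl]
        simp only [leftTrans, MvPolynomial.aeval_X, Sum.elim_inl, map_sum, leftDer_C_mul,
          leftDer_inl, map_mul, MvPolynomial.algHom_C, Finset.mul_sum, Finset.sum_mul]
        rw [Finset.sum_comm]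
        exact Finset.sum_congr rfl fun k _ => Finset.sum_congr rfl fun l _ => by
          simp only [MvPolynomial.algebraMap_eq]; ring
      · rw [leftDer_inr]
        simp only [leftTrans, MvPolynomial.aeval_X, Sum.elim_inr, map_sum, leftDer_C_mul, map_neg,
          leftDer_inr, map_mul, MvPolynomial.algHom_C, Finset.mul_sum, mul_neg,
          Finset.sum_neg_distrib]
        rw [Finset.sum_comm]
        exact congrArg _ (Finset.sum_congr rfl fun k _ => Finset.sum_congr rfl fun l _ => by
          simp only [MvPolynomial.algebraMap_eq]; ring)
    rw [map_mul, Derivation.leibniz, Derivation.leibniz, hX, h]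
    simp [map_add, map_mul]

/-- `x` is tangent to `H` at the identity: the derivative at `1` in the direction `x` of every
regular function that vanishes on `H` is zero. -/
def IsTangent (H : Subgroup (GL (Fin n) K)) (x : Matrix (Fin n) (Fin n) K) : Prop :=
  ∀ f : Coord n K, (∀ g ∈ H, evalAt g f = 0) → evalAt 1 (leftDer x f) = 0

lemma IsTangent.vanish {H : Subgroup (GL (Fin n) K)} {x : Matrix (Fin n) (Fin n) K}
    (hx : IsTangent H x) {f : Coord n K} (hf : ∀ g ∈ H, evalAt g f = 0) :
    ∀ g ∈ H, evalAt g (leftDer x f) = 0 := by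
  intro g hg
  have := hx (leftTrans g f) fun t ht => by
    rw [evalAt_leftTrans]; exact hf _ (H.mul_mem hg ht)
  rwa [leftDer_leftTrans, evalAt_leftTrans, mul_one] at this

/-- The Lie algebra of `H`: its tangent space at the identity, inside `gl_n(K)` with the commutator
bracket. Its `p`-th power map, in characteristic `p`, is the `p`-th power of matrices. -/
def lieAlg (H : Subgroup (GL (Fin n) K)) : LieSubalgebra K (Matrix (Fin n) (Fin n) K) where
  carrier := {x | IsTangent H x}
  add_mem' := fun {x y} hx hy f hf => by
    rw [leftDer_add, Derivation.add_apply, map_add, hx f hf, hy f hf, add_zero]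
  zero_mem' := fun f _ => by
    have : leftDer (0 : Matrix (Fin n) (Fin n) K) = 0 := by
      simpa using leftDer_smul (0 : K) (0 : Matrix (Fin n) (Fin n) K)
    simp [this]
  smul_mem' := fun c x hx f hf => by
    rw [leftDer_smul, Derivation.smul_apply, map_smul, hx f hf, smul_zero]
  lie_mem' := fun {x y} hx hy f hf => by
    rw [leftDer_lie, Derivation.commutator_apply, map_sub,
      hx _ (IsTangent.vanish hy hf), hy _ (IsTangent.vanish hx hf), sub_zero]

lemma lieAlg_mono {H H' : Subgroup (GL (Fin n) K)} (h : H ≤ H') : lieAlg H ≤ lieAlg H' :=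
  fun _ hx f hf => hx f fun g hg => hf g (h hg)

/-- A homomorphism `H → Kˣ` is regular if it is the restriction of a regular function. -/
def IsRegularChar (H : Subgroup (GL (Fin n) K)) (c : H →* Kˣ) : Prop :=
  ∃ f : Coord n K, ∀ t : H, ((c t : Kˣ) : K) = evalAt (t : GL (Fin n) K) f

/-- The characters of `H`, as a multiplicative group. -/
def characters (H : Subgroup (GL (Fin n) K)) : Subgroup (H →* Kˣ) where
  carrier := {c | IsRegularChar H c}
  mul_mem' := by
    rintro c c' ⟨f, hf⟩ ⟨f', hf'⟩
    exact ⟨f * f', fun t => by simp [hf, hf']⟩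
  one_mem' := ⟨1, fun t => by simp⟩
  inv_mem' := by
    rintro c ⟨f, hf⟩
    refine ⟨MvPolynomial.rename Sum.swap f, fun t => ?_⟩
    have h1 : (((c⁻¹ : H →* Kˣ) t : Kˣ) : K) = ((c t⁻¹ : Kˣ) : K) := by simp
    rw [h1, hf, evalAt, evalAt, MvPolynomial.aeval_rename]
    congr 1
    congr 1
    funext a
    rcases a with a | a <;> simp

/-- The character group `X(H)`, written additively. -/
abbrev CharLattice (H : Subgroup (GL (Fin n) K)) : Type u := Additive (characters H)

/-- The value `μ(t)` of a character `μ ∈ X(H)`. -/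
def charVal {H : Subgroup (GL (Fin n) K)} (μ : CharLattice H) (t : H) : K :=
  (((Additive.toMul μ : characters H) : H →* Kˣ) t : Kˣ)

lemma exists_regular {H : Subgroup (GL (Fin n) K)} (μ : CharLattice H) :
    ∃ f : Coord n K, ∀ t : H, charVal μ t = evalAt (t : GL (Fin n) K) f :=
  (Additive.toMul μ : characters H).2

lemma charVal_mul {H : Subgroup (GL (Fin n) K)} (μ : CharLattice H) (s t : H) :
    charVal μ (s * t) = charVal μ s * charVal μ t := by
  simp [charVal]

lemma charVal_one {H : Subgroup (GL (Fin n) K)} (μ : CharLattice H) : charVal μ 1 = 1 := by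
  simp [charVal]

/-- The differential `dμ : Lie(H) → K` of a character at the identity: the derivative at `1` of any
regular function that restricts to `μ`. -/
def dchar {H : Subgroup (GL (Fin n) K)} (μ : CharLattice H) : lieAlg H →ₗ[K] K where
  toFun x := evalAt 1 (leftDer (x : Matrix (Fin n) (Fin n) K) (exists_regular μ).choose)
  map_add' x y := by simp [leftDer_add]
  map_smul' c x := by simp [leftDer_smul]

/-- The differential does not depend on the chosen regular function. -/
lemma dchar_eq {H : Subgroup (GL (Fin n) K)} (μ : CharLattice H) (f : Coord n K)
    (hf : ∀ t : H, charVal μ t = evalAt (t : GL (Fin n) K) f) (x : lieAlg H) :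
    dchar μ x = evalAt 1 (leftDer (x : Matrix (Fin n) (Fin n) K) f) := by
  have h := x.2 ((exists_regular μ).choose - f) fun g hg => by
    rw [map_sub, ← (exists_regular μ).choose_spec ⟨g, hg⟩, ← hf ⟨g, hg⟩, sub_self]
  rw [map_sub, map_sub, sub_eq_zero] at h
  exact h

lemma dchar_lie {H : Subgroup (GL (Fin n) K)} (μ : CharLattice H) (x y : lieAlg H) :
    dchar μ ⁅x, y⁆ = 0 := by
  obtain ⟨f, hf⟩ := exists_regular μ
  have h1 : ∀ z : lieAlg H, ∀ g ∈ H,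
      evalAt g (leftDer (z : Matrix (Fin n) (Fin n) K) f - MvPolynomial.C (dchar μ z) * f) = 0 := by
    intro z g hg
    have h := z.2 (leftTrans g f - MvPolynomial.C (charVal μ ⟨g, hg⟩) * f) fun t ht => by
      have h2 := hf (⟨g, hg⟩ * ⟨t, ht⟩)
      rw [charVal_mul] at h2
      rw [map_sub, evalAt_leftTrans, map_mul, MvPolynomial.algHom_C, ← hf ⟨t, ht⟩]
      simpa [sub_eq_zero] using h2.symm
    rw [map_sub, leftDer_leftTrans, leftDer_C_mul, map_sub, evalAt_leftTrans, mul_one, map_mul,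
      MvPolynomial.algHom_C, ← dchar_eq μ f hf z] at h
    rw [map_sub, map_mul, MvPolynomial.algHom_C, ← hf ⟨g, hg⟩]
    simp only [Algebra.algebraMap_self, RingHom.id_apply] at h ⊢
    rw [mul_comm]
    exact h
  have h3 : ∀ z w : lieAlg H, evalAt 1 (leftDer (w : Matrix (Fin n) (Fin n) K)
      (leftDer (z : Matrix (Fin n) (Fin n) K) f)) = dchar μ z * dchar μ w := by
    intro z w
    have h := w.2 _ (h1 z)
    rw [map_sub, leftDer_C_mul, map_sub, map_mul, MvPolynomial.algHom_C, ← dchar_eq μ f hf w,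
      sub_eq_zero] at h
    simpa using h
  rw [dchar_eq μ f hf, LieSubalgebra.coe_bracket, leftDer_lie, Derivation.commutator_apply,
    map_sub, h3, h3]
  ring

/-- The root space `𝔤_α` for the adjoint action (conjugation) of `T` on `𝔤 = Lie(G)`. -/
def rootSpace (G T : Subgroup (GL (Fin n) K)) (α : CharLattice T) : Submodule K (lieAlg G) where
  carrier := {x | ∀ t : T, ((t : GL (Fin n) K) : Matrix (Fin n) (Fin n) K) * x.1 *
    (((t : GL (Fin n) K)⁻¹ : GL (Fin n) K) : Matrix (Fin n) (Fin n) K) = charVal α t • x.1}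
  add_mem' := fun {x y} hx hy t => by
    have := congrArg₂ (· + ·) (hx t) (hy t)
    simpa [mul_add, add_mul] using this
  zero_mem' := fun t => by simp
  smul_mem' := fun c x hx t => by
    have := congrArg (c • ·) (hx t)
    simpa [smul_comm c] using this

/-- The roots: the nonzero weights of `T` on `𝔤`. -/
def roots (G T : Subgroup (GL (Fin n) K)) : Set (CharLattice T) :=
  {α | α ≠ 0 ∧ rootSpace G T α ≠ ⊥}

/-- The positive roots with respect to `B`: those whose root space lies in `Lie(B)`. -/
def posRoots (G T B : Subgroup (GL (Fin n) K)) : Set (CharLattice T) :=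
  {α | α ∈ roots G T ∧ ∀ x ∈ rootSpace G T α, (x : Matrix (Fin n) (Fin n) K) ∈ lieAlg B}

/-- The simple roots: the positive roots that are not a sum of two positive roots. -/
def simpleRoots (G T B : Subgroup (GL (Fin n) K)) : Set (CharLattice T) :=
  {α | α ∈ posRoots G T B ∧ ∀ β ∈ posRoots G T B, ∀ γ ∈ posRoots G T B, α ≠ β + γ}

end AlgebraicGroups

/-! ## The fixed data -/

/-- A connected reductive group `G` with maximal torus `T` and Borel subgroup `B ⊇ T`, a basis
`{e_α, h_i}` of its Lie algebra, and a linear form `χ` in standard Levi form for a set `I` of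
simple roots. -/
structure LeviDatum (K : Type u) [Field K] (p : ℕ) where
  n : ℕ
  G : Subgroup (GL (Fin n) K)
  T : Subgroup (GL (Fin n) K)
  B : Subgroup (GL (Fin n) K)
  reductive : IsConnectedReductive G
  maxTorus : IsMaximalTorus G T
  borel : IsBorel G B
  T_le_B : T ≤ B
  /-- the root vectors -/
  e : roots G T → lieAlg G
  e_mem : ∀ α : roots G T, e α ∈ rootSpace G T α
  /-- the rank of `T` -/
  d : ℕ
  /-- the basis `h_1, …, h_d` of `Lie(T)` -/
  hb : Module.Basis (Fin d) K (lieAlg T)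
  /-- `h_i^[p] = h_i` -/
  hb_pow : ∀ i, (hb i : Matrix (Fin n) (Fin n) K) ^ p = (hb i : Matrix (Fin n) (Fin n) K)
  /-- the `e_α` together with the `h_i` form a basis of `𝔤` -/
  basis_linearIndependent : LinearIndependent K
    (Sum.elim e fun i => LieSubalgebra.inclusion (lieAlg_mono maxTorus.prop.1) (hb i))
  basis_span : Submodule.span K (Set.range
    (Sum.elim e fun i => LieSubalgebra.inclusion (lieAlg_mono maxTorus.prop.1) (hb i))) = ⊤
  I : Set (CharLattice T)
  I_subset : I ⊆ simpleRoots G T B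
  χ : Module.Dual K (lieAlg G)
  χ_borel : ∀ x : lieAlg G, (x : Matrix (Fin n) (Fin n) K) ∈ lieAlg B → χ x = 0
  χ_mem : ∀ α ∈ posRoots G T B, ∀ β : roots G T, (β : CharLattice T) = -α → α ∈ I → χ (e β) = 1
  χ_notMem : ∀ α ∈ posRoots G T B, ∀ β : roots G T, (β : CharLattice T) = -α → α ∉ I → χ (e β) = 0

namespace LeviDatum

variable {K : Type u} [Field K] {p : ℕ} (D : LeviDatum K p)

/-- `𝔤 = Lie(G)` -/
abbrev g : LieSubalgebra K (Matrix (Fin D.n) (Fin D.n) K) := lieAlg D.G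

/-- `𝔥 = Lie(T)` -/
abbrev h : LieSubalgebra K (Matrix (Fin D.n) (Fin D.n) K) := lieAlg D.T

/-- The inclusion `𝔥 → 𝔤`. -/
def incl : D.h →ₗ⁅K⁆ D.g := LieSubalgebra.inclusion (lieAlg_mono D.maxTorus.prop.1)

/-- The character group `X = X(T)`. -/
abbrev X : Type u := CharLattice D.T

/-- The set of roots `R`. -/
abbrev R : Type u := roots D.G D.T

/-- `X/ℤI` -/
abbrev XI : Type u := D.X ⧸ AddSubgroup.closure D.I

/-- The coset `μ + ℤI`. -/
abbrev coset (μ : D.X) : D.XI := QuotientAddGroup.mk μ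

/-- `μ ∈ lam + pX`, where `lam` is a coset of `ℤI` in `X`. -/
def Admissible (lam : D.XI) (μ : D.X) : Prop := ∃ τ : D.X, D.coset (μ - p • τ) = lam

/-- The relations `e_α ^ p = χ(e_α) ^ p`. -/
inductive URel : UniversalEnvelopingAlgebra K D.g → UniversalEnvelopingAlgebra K D.g → Prop
  | of (α : D.R) : URel (UniversalEnvelopingAlgebra.ι K (D.e α) ^ p)
      (algebraMap K (UniversalEnvelopingAlgebra K D.g) (D.χ (D.e α) ^ p))

/-- The algebra `U_χ = U(𝔤) / ⟨e_α ^ p - χ(e_α) ^ p⟩`. -/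
abbrev Uχ : Type u := RingQuot D.URel

/-- The algebra `U⁰ = U(𝔥)`. -/
abbrev U0 : Type u := UniversalEnvelopingAlgebra K D.h

/-- The canonical map `𝔤 → U_χ`. -/
def gToU (x : D.g) : D.Uχ := RingQuot.mkAlgHom K D.URel (UniversalEnvelopingAlgebra.ι K x)

/-- The canonical map `U⁰ → U_χ`. -/
def U0toU : D.U0 →ₐ[K] D.Uχ :=
  (RingQuot.mkAlgHom K D.URel).comp
    (UniversalEnvelopingAlgebra.lift K ((UniversalEnvelopingAlgebra.ι K).comp D.incl))

/-- The generators `e_α` and `h ∈ 𝔥` of `U_χ`. -/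
def gen : D.R ⊕ D.h → D.Uχ := Sum.elim (fun α => D.gToU (D.e α)) (fun s => D.gToU (D.incl s))

/-- Their degrees: `e_α` has degree `α + ℤI` and `h ∈ 𝔥` has degree `0`. -/
def genDeg : D.R ⊕ D.h → D.XI := Sum.elim (fun α => D.coset α) (fun _ => 0)

/-- The homogeneous part `(U_χ)_σ`: the span of the monomials of degree `σ` in the generators. -/
def UGr (σ : D.XI) : Submodule K D.Uχ :=
  Submodule.span K {a | ∃ l : List (D.R ⊕ D.h), (l.map D.genDeg).sum = σ ∧ a = (l.map D.gen).prod}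

/-- The Lie algebra map `𝔥 → U⁰`, `h ↦ h + dμ(h)`. -/
def shiftLie (μ : D.X) : D.h →ₗ⁅K⁆ D.U0 :=
  { (UniversalEnvelopingAlgebra.ι K : D.h →ₗ⁅K⁆ D.U0).toLinearMap +
      (Algebra.linearMap K D.U0).comp (dchar μ) with
    map_lie' := by
      intro x y
      have h1 : ∀ (a b : D.U0) (c c' : K),
          ⁅a + algebraMap K D.U0 c, b + algebraMap K D.U0 c'⁆ = ⁅a, b⁆ := by
        intro a b c c'
        simp only [Ring.lie_def, add_mul, mul_add, Algebra.commutes c b, Algebra.commutes c' a,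
          Algebra.commutes c' (algebraMap K D.U0 c)]
        abel
      simp [dchar_lie, h1] }

/-- The algebra endomorphism `μ̃` of `U⁰` with `μ̃(h) = h + dμ(h)` for `h ∈ 𝔥`. -/
def shift (μ : D.X) : D.U0 →ₐ[K] D.U0 := UniversalEnvelopingAlgebra.lift K (D.shiftLie μ)

end LeviDatum

/-! ## The category `𝒞_A` -/

section Category

variable {K : Type u} [Field K] {p : ℕ} (D : LeviDatum K p) (A : Type v) [CommRing A] [Algebra K A]

/-- An `A`-module with an `X/ℤI`-grading by `A`-submodules, finitely many of which are nonzero and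
all of which are finitely generated, and with a decomposition of each homogeneous part
`M_lam = ⨁ M_lam^{dμ}` into `A`-submodules, indexed by the differentials `dμ ∈ 𝔥^*` of the
`μ ∈ lam + pX`. Here `M_lam^ξ` is written `wt lam ξ`, with the convention that it is zero if `ξ` is
not of the form `dμ` with `μ ∈ lam + pX`. -/
structure GrMod where
  carrier : Type w
  [addCommGroup : AddCommGroup carrier]
  [moduleK : Module K carrier]
  [module : Module A carrier]
  [isScalarTower : IsScalarTower K A carrier]
  gr : D.XI → Submodule A carrier
  gr_indep : iSupIndep gr
  gr_top : ⨆ lam, gr lam = ⊤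
  gr_finite : {lam | gr lam ≠ ⊥}.Finite
  gr_fg : ∀ lam, (gr lam).FG
  wt : D.XI → Module.Dual K D.h → Submodule A carrier
  wt_bot : ∀ lam ξ, (¬ ∃ μ, D.Admissible lam μ ∧ dchar μ = ξ) → wt lam ξ = ⊥
  wt_indep : ∀ lam, iSupIndep (wt lam)
  wt_sup : ∀ lam, ⨆ ξ, wt lam ξ = gr lam

attribute [instance] GrMod.addCommGroup GrMod.moduleK GrMod.module GrMod.isScalarTower

variable {D A}

/-- Homomorphisms of `A`-modules which send `M_lam^{dμ}` to `N_lam^{dμ}`. -/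
@[ext]
structure GrMod.Hom (M N : GrMod.{u, v, w} D A) where
  toLin : M.carrier →ₗ[A] N.carrier
  map_wt : ∀ lam ξ, ∀ m ∈ M.wt lam ξ, toLin m ∈ N.wt lam ξ

instance : Category (GrMod.{u, v, w} D A) where
  Hom M N := GrMod.Hom M N
  id M := ⟨LinearMap.id, fun _ _ _ hm => hm⟩
  comp f g := ⟨g.toLin.comp f.toLin, fun lam ξ m hm => g.map_wt lam ξ _ (f.map_wt lam ξ m hm)⟩

/-- The conditions relating an action of `U_χ` on a graded `A`-module, the grading and the structure
map `π : U⁰ → A`. -/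
structure IsAction (π : D.U0 →ₐ[K] A) (M : GrMod.{u, v, w} D A)
    (ρ : D.Uχ →ₐ[K] Module.End A M.carrier) : Prop where
  /-- `(U_χ)_σ M_lam ⊆ M_{σ + lam}` -/
  graded : ∀ σ lam, ∀ a ∈ D.UGr σ, ∀ m ∈ M.gr lam, ρ a m ∈ M.gr (σ + lam)
  /-- `s m = m π(μ̃(s))` for `m ∈ M_lam^{dμ}` -/
  weight : ∀ lam μ, D.Admissible lam μ → ∀ s : D.U0, ∀ m ∈ M.wt lam (dchar μ),
    ρ (D.U0toU s) m = π (D.shift μ s) • m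
  /-- `e_α M_lam^{dμ} ⊆ M_{lam + α}^{d(μ + α)}` -/
  root : ∀ (α : D.R) (lam) (μ), D.Admissible lam μ → ∀ m ∈ M.wt lam (dchar μ),
    ρ (D.gToU (D.e α)) m ∈ M.wt (lam + D.coset α) (dchar (μ + (α : D.X)))

variable (D A)

/-- The objects of `𝒞_A`, for the structure map `π`. A `U_χ ⊗ A`-module is given as an `A`-module
`M` with a homomorphism of `K`-algebras `U_χ → End_A(M)`. -/
structure CObj (π : D.U0 →ₐ[K] A) where
  base : GrMod.{u, v, w} D A
  ρ : D.Uχ →ₐ[K] Module.End A base.carrier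
  isAction : IsAction π base ρ

variable {D A}

/-- The morphisms of `𝒞_A`: the homomorphisms of `U_χ ⊗ A`-modules which send `M_lam^{dμ}` to
`N_lam^{dμ}`. -/
@[ext]
structure CObj.Hom {π : D.U0 →ₐ[K] A} (M N : CObj.{u, v, w} D A π) where
  toHom : M.base ⟶ N.base
  map_act : ∀ (a : D.Uχ) (m : M.base.carrier), toHom.toLin (M.ρ a m) = N.ρ a (toHom.toLin m)

/-- The category `𝒞_A`. -/
instance (π : D.U0 →ₐ[K] A) : Category (CObj.{u, v, w} D A π) where
  Hom M N := CObj.Hom M N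
  id M := ⟨𝟙 M.base, fun _ _ => rfl⟩
  comp f g := ⟨f.toHom ≫ g.toHom, fun a m =>
    (congrArg g.toHom.toLin (f.map_act a m)).trans (g.map_act a (f.toHom.toLin m))⟩

/-- The functor that forgets the action of `U_χ` and keeps the `A`-module, the grading and the
summands `M_lam^{dμ}`. -/
def forgetAction (π : D.U0 →ₐ[K] A) : CObj.{u, v, w} D A π ⥤ GrMod.{u, v, w} D A where
  obj M := M.base
  map f := f.toHom

variable (D A)

/-- The structure map `π° : U⁰ → K → A` which sends every `h ∈ 𝔥` to zero. -/
def piZero : D.U0 →ₐ[K] A :=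
  (Algebra.ofId K A).comp (UniversalEnvelopingAlgebra.lift K (0 : D.h →ₗ⁅K⁆ K))

end Category

end ReducedEnveloping

end

/-!
Write `ψ : 𝔥 → A` for the difference of two structure maps and extend it by zero on the root vectors
to `φ : 𝔤 → A`. The bracket of two root spaces `𝔤_α`, `𝔤_β` lies in `𝔤_{α + β}`, on which `φ`
vanishes unless `β = -α`, and `𝔥` is abelian. Hence `φ` is a character of `𝔤` as soon as `ψ` kills
every `[e_α, e_{-α}]`, and tensoring with it, that is, letting `x ∈ 𝔤` act as `x + φ(x)`, turns
objects for one structure map into objects for the other. The root vectors act as before, so the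
relations of `U_χ` are preserved, and `-φ` gives the inverse.
-/

noncomputable section

namespace ReducedEnveloping

lemma coeff_mul_eq_of_linearIndependent_eigenvectors {ι R M : Type*} [CommRing R] [AddCommGroup M]
    [Module R M] {v : ι → M} (hv : LinearIndependent R v) {f : Module.End R M} {c : ι → R}
    (hf : ∀ i, f (v i) = c i • v i) {l : ι →₀ R} {a : R}
    (hl : f (Finsupp.linearCombination R v l) = a • Finsupp.linearCombination R v l) (i : ι) :
    c i * l i = a * l i := by
  have hscale (l : ι →₀ R) :
      Finsupp.linearCombination R v (c • l) = f (Finsupp.linearCombination R v l) := by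
    induction l using Finsupp.induction_linear with
    | zero => simp
    | add l l' hl hl' => rw [smul_add, map_add, map_add, map_add, hl, hl']
    | single i a =>
      have hsingle : c • Finsupp.single i a = Finsupp.single i (a * c i) := by
        ext j
        by_cases hj : i = j <;> simp [hj, mul_comm]
      rw [hsingle, Finsupp.linearCombination_single, Finsupp.linearCombination_single, map_smul,
        hf, smul_smul]
  have hcl : c • l = a • l := hv (by rw [hscale, hl, map_smul])
  simpa using DFunLike.congr_fun hcl i

section Generators

variable {K U A M : Type*} [CommRing K] [Ring U] [Algebra K U] [CommRing A] [Algebra K A]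
  [AddCommGroup M] [Module K M] [Module A M] [IsScalarTower K A M] {S : Set U}

lemma apply_eq_smul_of_adjoin_eq_top (hS : Algebra.adjoin K S = ⊤)
    {ρ : U →ₐ[K] Module.End A M} {c : U →ₐ[K] A} {m : M} (h : ∀ a ∈ S, ρ a m = c a • m) (a : U) :
    ρ a m = c a • m := by
  have ha : a ∈ Algebra.adjoin K S := hS ▸ Algebra.mem_top
  induction ha using Algebra.adjoin_induction with
  | mem a ha => exact h a ha
  | algebraMap r => simp
  | add a b _ _ ha hb => simp only [map_add, LinearMap.add_apply, ha, hb, add_smul]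
  | mul a b _ _ ha hb =>
    rw [map_mul, map_mul, Module.End.mul_apply, hb, map_smul, ha, smul_smul, mul_comm]

lemma map_apply_of_adjoin_eq_top {N : Type*} [AddCommGroup N] [Module K N] [Module A N]
    [IsScalarTower K A N] (hS : Algebra.adjoin K S = ⊤) {ρ : U →ₐ[K] Module.End A M}
    {ρ' : U →ₐ[K] Module.End A N} {f : M →ₗ[A] N}
    (h : ∀ a ∈ S, ∀ m, f (ρ a m) = ρ' a (f m)) (a : U) (m : M) : f (ρ a m) = ρ' a (f m) := by
  have ha : a ∈ Algebra.adjoin K S := hS ▸ Algebra.mem_top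
  induction ha using Algebra.adjoin_induction generalizing m with
  | mem a ha => exact h a ha m
  | algebraMap r => simp only [AlgHom.commutes, Module.algebraMap_end_apply, f.map_smul_of_tower]
  | add a b _ _ ha hb => simp only [map_add, LinearMap.add_apply, ha, hb]
  | mul a b _ _ ha hb => simp only [map_mul, Module.End.mul_apply, ha, hb]

end Generators

section LieAlgebras

variable {K L : Type*} [CommRing K] [LieRing L] [LieAlgebra K L]

lemma adjoin_range_ι :
    Algebra.adjoin K (Set.range (UniversalEnvelopingAlgebra.ι K :
      L → UniversalEnvelopingAlgebra K L)) = ⊤ := by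
  set S := Algebra.adjoin K (Set.range (UniversalEnvelopingAlgebra.ι K :
    L → UniversalEnvelopingAlgebra K L))
  let ιS : L →ₗ⁅K⁆ S :=
    { toFun x := ⟨UniversalEnvelopingAlgebra.ι K x, Algebra.subset_adjoin ⟨x, rfl⟩⟩
      map_add' x y := Subtype.ext (by simp)
      map_smul' c x := Subtype.ext (by simp)
      map_lie' {x y} := Subtype.ext (by simp [Ring.lie_def]) }
  have hid : S.val.comp (UniversalEnvelopingAlgebra.lift K ιS) = AlgHom.id K _ := by
    apply UniversalEnvelopingAlgebra.hom_ext
    ext x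
    simp [ιS]
  refine eq_top_iff.mpr fun a _ => ?_
  rw [← AlgHom.id_apply (R := K) a, ← hid]
  exact Subtype.property _

variable {A E : Type*} [CommRing A] [Algebra K A] [Ring E] [Algebra K E] [Algebra A E]

lemma lie_add_algebraMap_add_algebraMap (a b : E) (s t : A) :
    ⁅a + algebraMap A E s, b + algebraMap A E t⁆ = ⁅a, b⁆ := by
  simp only [Ring.lie_def, add_mul, mul_add, Algebra.commutes s b, Algebra.commutes t a,
    Algebra.commutes t (algebraMap A E s)]
  abel

/-- The twist `x ↦ f(x) + φ(x)` of a representation `f` of `L` by a character `φ` of `L` with values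
in a commutative algebra `A`; a character is given as a linear map that vanishes on brackets. -/
def twistLieHom [IsScalarTower K A E] (f : L →ₗ⁅K⁆ E) (φ : L →ₗ[K] A)
    (hφ : ∀ x y : L, φ ⁅x, y⁆ = 0) : L →ₗ⁅K⁆ E :=
  { (f : L →ₗ[K] E) + (IsScalarTower.toAlgHom K A E).toLinearMap ∘ₗ φ with
    map_lie' {x y} := by
      change f ⁅x, y⁆ + algebraMap A E (φ ⁅x, y⁆) =
        ⁅f x + algebraMap A E (φ x), f y + algebraMap A E (φ y)⁆
      rw [lie_add_algebraMap_add_algebraMap, hφ, map_zero, add_zero, LieHom.map_lie] }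

lemma twistLieHom_apply [IsScalarTower K A E] (f : L →ₗ⁅K⁆ E) (φ : L →ₗ[K] A)
    (hφ : ∀ x y : L, φ ⁅x, y⁆ = 0) (x : L) : twistLieHom f φ hφ x = f x + algebraMap A E (φ x) :=
  rfl

end LieAlgebras

section Weights

variable {n : ℕ} {K : Type u} [Field K]

lemma charVal_add {H : Subgroup (GL (Fin n) K)} (μ ν : CharLattice H) (t : H) :
    charVal (μ + ν) t = charVal μ t * charVal ν t := by
  simp [charVal]

lemma charVal_zero {H : Subgroup (GL (Fin n) K)} (t : H) : charVal (0 : CharLattice H) t = 1 := by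
  simp [charVal]

lemma charVal_injective {H : Subgroup (GL (Fin n) K)} :
    Function.Injective (charVal : CharLattice H → H → K) := fun _ _ h =>
  Additive.toMul.injective (Subtype.ext (MonoidHom.ext fun t => Units.ext (congrFun h t)))

lemma mem_rootSpace_iff {G T : Subgroup (GL (Fin n) K)} {α : CharLattice T} {x : lieAlg G} :
    x ∈ rootSpace G T α ↔ ∀ t : T,
      ConjAct.toConjAct (t : GL (Fin n) K) • (x : Matrix (Fin n) (Fin n) K) =
        charVal α t • (x : Matrix (Fin n) (Fin n) K) :=
  Iff.rfl

lemma lie_mem_rootSpace {G T : Subgroup (GL (Fin n) K)} {α β : CharLattice T} {x y : lieAlg G}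
    (hx : x ∈ rootSpace G T α) (hy : y ∈ rootSpace G T β) : ⁅x, y⁆ ∈ rootSpace G T (α + β) := by
  rw [mem_rootSpace_iff] at hx hy ⊢
  intro t
  rw [LieSubalgebra.coe_bracket, Ring.lie_def, smul_sub, smul_mul', smul_mul', hx, hy, charVal_add,
    smul_mul_smul_comm, smul_mul_smul_comm, mul_comm (charVal β t), smul_sub]

lemma commute_of_mem_lieAlg {H : Subgroup (GL (Fin n) K)} {a x : Matrix (Fin n) (Fin n) K}
    (ha : ∀ s ∈ H, Commute a (s : Matrix (Fin n) (Fin n) K)) (hx : x ∈ lieAlg H) : Commute a x := by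
  ext i j
  -- The derivative in the direction `x` of the `(i, j)` entry of `a s - s a`, a function of `s`.
  have h := hx (∑ k, MvPolynomial.C (a i k) * MvPolynomial.X (Sum.inl (k, j)) -
    ∑ k, MvPolynomial.C (a k j) * MvPolynomial.X (Sum.inl (i, k))) fun s hs => by
      have hij := congrFun (congrFun (ha s hs) i) j
      simp only [Matrix.mul_apply] at hij
      simp [evalAt, hij, mul_comm]
  simp only [map_sub, map_sum, leftDer_C_mul, leftDer_inl] at h
  simpa [evalAt, Matrix.one_apply, Matrix.mul_apply, sub_eq_zero, mul_comm] using h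

lemma IsTorus.commute {T : Subgroup (GL (Fin n) K)} (hT : IsTorus T) {s t : GL (Fin n) K}
    (hs : s ∈ T) (ht : t ∈ T) : Commute s t := by
  obtain ⟨-, -, q, hq⟩ := hT
  suffices Commute (MulAut.conj q s) (MulAut.conj q t) from
    (MulAut.conj q).injective (by simpa only [map_mul] using this.eq)
  apply Units.ext
  simp only [MulAut.conj_apply]
  rw [Units.val_mul (q * s * q⁻¹), Units.val_mul (q * t * q⁻¹), ← (hq s hs).diagonal_diag,
    ← (hq t ht).diagonal_diag]
  exact Matrix.commute_diagonal _ _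

lemma IsTorus.isLieAbelian_lieAlg {T : Subgroup (GL (Fin n) K)} (hT : IsTorus T) :
    IsLieAbelian (lieAlg T) where
  trivial x y := by
    have hT_y : ∀ s ∈ T, Commute (s : Matrix (Fin n) (Fin n) K) y := fun s hs =>
      commute_of_mem_lieAlg (fun t ht => congrArg Units.val (hT.commute hs ht)) y.2
    have hxy : Commute (y : Matrix (Fin n) (Fin n) K) x :=
      commute_of_mem_lieAlg (fun s hs => (hT_y s hs).symm) x.2
    apply Subtype.ext
    rw [LieSubalgebra.coe_bracket, Ring.lie_def, hxy.eq, sub_self, ZeroMemClass.coe_zero]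

lemma IsTorus.inclusion_mem_rootSpace_zero {G T : Subgroup (GL (Fin n) K)} (hT : IsTorus T)
    (hTG : T ≤ G) (x : lieAlg T) :
    LieSubalgebra.inclusion (lieAlg_mono hTG) x ∈ rootSpace G T 0 := by
  rw [mem_rootSpace_iff]
  intro t
  have htx : Commute ((t : GL (Fin n) K) : Matrix (Fin n) (Fin n) K) x :=
    commute_of_mem_lieAlg (fun s hs => congrArg Units.val (hT.commute t.2 hs)) x.2
  rw [charVal_zero, one_smul, ConjAct.units_smul_def, ConjAct.ofConjAct_toConjAct]
  change _ * (x : Matrix (Fin n) (Fin n) K) * _ = (x : Matrix (Fin n) (Fin n) K)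
  rw [htx.eq, mul_assoc, Units.mul_inv, mul_one]

end Weights

namespace LeviDatum

variable {K : Type u} [Field K] {p : ℕ} (D : LeviDatum K p)

section Basis

/-- The basis of `𝔤` that consists of the root vectors `e_α` and the chosen basis `h_i` of `𝔥`. -/
def basis : Module.Basis (D.R ⊕ Fin D.d) K D.g :=
  Module.Basis.mk D.basis_linearIndependent D.basis_span.ge

lemma basis_inl (α : D.R) : D.basis (Sum.inl α) = D.e α := by
  simp [basis]

lemma basis_inr (i : Fin D.d) : D.basis (Sum.inr i) = D.incl (D.hb i) := by
  simp [basis, incl]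

/-- The weights for `T` of the elements of `LeviDatum.basis`: `e_α` has weight `α` and `h_i` has
weight `0`. -/
def basisWeight : D.R ⊕ Fin D.d → D.X := Sum.elim (fun α => α) fun _ => 0

lemma basis_mem_rootSpace (b : D.R ⊕ Fin D.d) :
    D.basis b ∈ rootSpace D.G D.T (D.basisWeight b) := by
  rcases b with α | i
  · rw [basis_inl]
    exact D.e_mem α
  · rw [basis_inr]
    exact D.maxTorus.prop.2.inclusion_mem_rootSpace_zero D.maxTorus.prop.1 _

lemma basis_repr_eq_zero_of_basisWeight_ne {γ : D.X} {x : D.g} (hx : x ∈ rootSpace D.G D.T γ)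
    {b : D.R ⊕ Fin D.d} (hb : D.basisWeight b ≠ γ) : D.basis.repr x b = 0 := by
  obtain ⟨t, ht⟩ := Function.ne_iff.mp (charVal_injective.ne hb)
  let coe : D.g →ₗ[K] Matrix (Fin D.n) (Fin D.n) K := D.g.toSubmodule.subtype
  have hcoe : Finsupp.linearCombination K (coe ∘ D.basis) (D.basis.repr x) = x := by
    rw [← Finsupp.apply_linearCombination, D.basis.linearCombination_repr]
    rfl
  have heq := coeff_mul_eq_of_linearIndependent_eigenvectors
    (D.basis.linearIndependent.map' coe (Submodule.ker_subtype _))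
    (f := DistribSMul.toLinearMap K _ (ConjAct.toConjAct (t : GL (Fin D.n) K)))
    (fun c => D.basis_mem_rootSpace c t) (l := D.basis.repr x) (by rw [hcoe]; exact hx t) b
  by_contra hne
  exact ht (mul_right_cancel₀ hne heq)

lemma exists_incl_eq_of_mem_rootSpace_zero {x : D.g} (hx : x ∈ rootSpace D.G D.T 0) :
    ∃ s, D.incl s = x := by
  suffices x ∈ LinearMap.range (D.incl : D.h →ₗ[K] D.g) from this
  rw [← D.basis.linearCombination_repr x, Finsupp.linearCombination_apply]
  refine Submodule.sum_mem _ fun b hb => Submodule.smul_mem _ _ ?_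
  rcases b with α | i
  · exact absurd (D.basis_repr_eq_zero_of_basisWeight_ne hx (b := Sum.inl α) α.2.1)
      (Finsupp.mem_support_iff.mp hb)
  · exact ⟨D.hb i, (D.basis_inr i).symm⟩

end Basis

section ExtendByZero

variable {V : Type*} [AddCommGroup V] [Module K V] (ψ : D.h →ₗ[K] V)

/-- The extension of a linear map on `𝔥` to `𝔤` that vanishes on the root vectors. -/
def extendByZero : D.g →ₗ[K] V :=
  D.basis.constr K (Sum.elim 0 (ψ ∘ D.hb))

lemma extendByZero_e (α : D.R) : D.extendByZero ψ (D.e α) = 0 := by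
  rw [← basis_inl, extendByZero, Module.Basis.constr_basis, Sum.elim_inl, Pi.zero_apply]

lemma extendByZero_incl (s : D.h) : D.extendByZero ψ (D.incl s) = ψ s := by
  suffices D.extendByZero ψ ∘ₗ (D.incl : D.h →ₗ[K] D.g) = ψ from LinearMap.congr_fun this s
  refine D.hb.ext fun i => ?_
  rw [LinearMap.comp_apply, LieHom.coe_toLinearMap, ← basis_inr, extendByZero,
    Module.Basis.constr_basis, Sum.elim_inr, Function.comp_apply]

lemma extendByZero_eq_zero_of_mem_rootSpace {γ : D.X} (hγ : γ ≠ 0) {x : D.g}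
    (hx : x ∈ rootSpace D.G D.T γ) : D.extendByZero ψ x = 0 := by
  rw [extendByZero, Module.Basis.constr_apply]
  refine Finset.sum_eq_zero fun b _ => ?_
  rcases b with α | i
  · simp
  · simp only [D.basis_repr_eq_zero_of_basisWeight_ne hx (b := Sum.inr i) hγ.symm,
      zero_smul]

variable {ψ}

lemma extendByZero_lie (hψ : ∀ α β : D.R, (β : D.X) = -(α : D.X) → ∀ s : D.h,
    D.incl s = ⁅D.e α, D.e β⁆ → ψ s = 0) (x y : D.g) : D.extendByZero ψ ⁅x, y⁆ = 0 := by
  have hbasis (b c) : D.extendByZero ψ ⁅D.basis b, D.basis c⁆ = 0 := by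
    have hmem := lie_mem_rootSpace (D.basis_mem_rootSpace b) (D.basis_mem_rootSpace c)
    by_cases h0 : D.basisWeight b + D.basisWeight c = 0
    · rcases b with α | i <;> rcases c with β | j
      · obtain ⟨s, hs⟩ := D.exists_incl_eq_of_mem_rootSpace_zero (h0 ▸ hmem)
        rw [basis_inl, basis_inl] at hs ⊢
        rw [← hs, extendByZero_incl]
        exact hψ α β (neg_eq_of_add_eq_zero_right h0).symm s hs
      · exact absurd ((add_zero _).symm.trans h0) α.2.1
      · exact absurd ((zero_add _).symm.trans h0) β.2.1
      · have := D.maxTorus.prop.2.isLieAbelian_lieAlg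
        rw [basis_inr, basis_inr, ← LieHom.map_lie, trivial_lie_zero, map_zero, map_zero]
    · exact D.extendByZero_eq_zero_of_mem_rootSpace ψ h0 hmem
  suffices (LieModule.toEnd K D.g D.g : D.g →ₗ[K] Module.End K D.g).compr₂ (D.extendByZero ψ) = 0
    from LinearMap.congr_fun₂ this x y
  exact D.basis.ext fun b => D.basis.ext fun c => hbasis b c

end ExtendByZero

section Enveloping

lemma adjoin_range_gToU : Algebra.adjoin K (Set.range D.gToU) = ⊤ := by
  have hrange : Set.range D.gToU = RingQuot.mkAlgHom K D.URel ''
      Set.range (UniversalEnvelopingAlgebra.ι K : D.g → UniversalEnvelopingAlgebra K D.g) :=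
    Set.range_comp _ _
  rw [hrange, ← AlgHom.map_adjoin, adjoin_range_ι, Algebra.map_top, AlgHom.range_eq_top]
  exact RingQuot.mkAlgHom_surjective K D.URel

lemma gToU_e_pow (α : D.R) :
    D.gToU (D.e α) ^ p = algebraMap K D.Uχ (D.χ (D.e α) ^ p) := by
  rw [gToU, ← map_pow, RingQuot.mkAlgHom_rel K (URel.of α), AlgHom.commutes]

lemma U0toU_ι (s : D.h) : D.U0toU (UniversalEnvelopingAlgebra.ι K s) = D.gToU (D.incl s) := by
  simp [U0toU, gToU]

lemma shift_ι (μ : D.X) (s : D.h) : D.shift μ (UniversalEnvelopingAlgebra.ι K s) =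
    UniversalEnvelopingAlgebra.ι K s + algebraMap K D.U0 (dchar μ s) := by
  rw [shift, UniversalEnvelopingAlgebra.lift_ι_apply]
  rfl

end Enveloping

section Twist

variable {A : Type*} [CommRing A] [Algebra K A]

/-- `φ` is a character of `𝔤` with values in `A`, i.e. a linear map that vanishes on brackets, and
it vanishes on the root vectors. These are the characters by which actions of `U_χ` can be
twisted. -/
structure IsTwistingCharacter (φ : D.g →ₗ[K] A) : Prop where
  map_e : ∀ α, φ (D.e α) = 0
  map_lie : ∀ x y : D.g, φ ⁅x, y⁆ = 0

variable {D} {φ : D.g →ₗ[K] A}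

lemma IsTwistingCharacter.neg (hφ : D.IsTwistingCharacter φ) : D.IsTwistingCharacter (-φ) where
  map_e α := by rw [LinearMap.neg_apply, hφ.map_e, neg_zero]
  map_lie x y := by rw [LinearMap.neg_apply, hφ.map_lie, neg_zero]

variable {E : Type*} [Ring E] [Algebra K E] [Algebra A E] [IsScalarTower K A E]

/-- The twist of an action `ρ` of `U_χ` by a character `φ`: `x ∈ 𝔤` acts as `ρ(x) + φ(x)`. -/
def twist (hφ : D.IsTwistingCharacter φ) (ρ : D.Uχ →ₐ[K] E) : D.Uχ →ₐ[K] E :=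
  RingQuot.liftAlgHom K ⟨UniversalEnvelopingAlgebra.lift K (twistLieHom
    ((ρ.comp (RingQuot.mkAlgHom K D.URel) : _ →ₗ⁅K⁆ E).comp (UniversalEnvelopingAlgebra.ι K))
    φ hφ.map_lie), by
      rintro _ _ ⟨α⟩
      rw [map_pow, UniversalEnvelopingAlgebra.lift_ι_apply, AlgHom.commutes, twistLieHom_apply,
        hφ.map_e, map_zero, add_zero]
      change ρ (D.gToU (D.e α)) ^ p = _
      rw [← map_pow, gToU_e_pow, AlgHom.commutes]⟩

lemma twist_gToU (hφ : D.IsTwistingCharacter φ) (ρ : D.Uχ →ₐ[K] E) (x : D.g) :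
    twist hφ ρ (D.gToU x) = ρ (D.gToU x) + algebraMap A E (φ x) := by
  rw [twist, gToU, RingQuot.liftAlgHom_mkAlgHom_apply, UniversalEnvelopingAlgebra.lift_ι_apply]
  rfl

lemma twist_e (hφ : D.IsTwistingCharacter φ) (ρ : D.Uχ →ₐ[K] E) (α : D.R) :
    twist hφ ρ (D.gToU (D.e α)) = ρ (D.gToU (D.e α)) := by
  rw [twist_gToU, hφ.map_e, map_zero, add_zero]

lemma twist_twist_of_add_eq_zero {φ' : D.g →ₗ[K] A} (hφ : D.IsTwistingCharacter φ)
    (hφ' : D.IsTwistingCharacter φ') (h : φ + φ' = 0) (ρ : D.Uχ →ₐ[K] E) :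
    twist hφ' (twist hφ ρ) = ρ := by
  refine AlgHom.ext_of_adjoin_eq_top D.adjoin_range_gToU ?_
  rintro _ ⟨x, rfl⟩
  rw [twist_gToU, twist_gToU, add_assoc, ← map_add, ← LinearMap.add_apply, h, LinearMap.zero_apply,
    map_zero, add_zero]

lemma map_twist_apply {M N : Type*} [AddCommGroup M] [Module K M] [Module A M]
    [IsScalarTower K A M] [AddCommGroup N] [Module K N] [Module A N] [IsScalarTower K A N]
    (hφ : D.IsTwistingCharacter φ) {ρ : D.Uχ →ₐ[K] Module.End A M}
    {ρ' : D.Uχ →ₐ[K] Module.End A N} {f : M →ₗ[A] N} (hf : ∀ a m, f (ρ a m) = ρ' a (f m)) :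
    ∀ a m, f (twist hφ ρ a m) = twist hφ ρ' a (f m) := by
  refine map_apply_of_adjoin_eq_top D.adjoin_range_gToU ?_
  rintro _ ⟨x, rfl⟩ m
  simp only [twist_gToU, LinearMap.add_apply, Module.algebraMap_end_apply, map_add, map_smul, hf]

end Twist

end LeviDatum

section Action

variable {K : Type u} [Field K] {p : ℕ} {D : LeviDatum K p} {A : Type v} [CommRing A] [Algebra K A]
  {π π' : D.U0 →ₐ[K] A} {M : GrMod.{u, v, w} D A} {ρ : D.Uχ →ₐ[K] Module.End A M.carrier}

lemma GrMod.apply_mem_gr_of_mem_UGr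
    (h : ∀ b lam, ∀ m ∈ M.gr lam, ρ (D.gen b) m ∈ M.gr (D.genDeg b + lam))
    {σ lam : D.XI} {a : D.Uχ} (ha : a ∈ D.UGr σ) {m : M.carrier} (hm : m ∈ M.gr lam) :
    ρ a m ∈ M.gr (σ + lam) := by
  induction ha using Submodule.span_induction with
  | mem a ha =>
    obtain ⟨l, rfl, rfl⟩ := ha
    induction l with
    | nil => simpa using hm
    | cons b l ih => simpa [add_assoc] using h b _ _ ih
  | zero => simp
  | add a b _ _ ha hb => simpa using add_mem ha hb
  | smul c a _ ha =>
    rw [map_smul, LinearMap.smul_apply, ← algebraMap_smul A c]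
    exact Submodule.smul_mem _ _ ha

lemma gen_mem_UGr (b : D.R ⊕ D.h) : D.gen b ∈ D.UGr (D.genDeg b) :=
  Submodule.subset_span ⟨[b], by simp, by simp⟩

variable {φ : D.g →ₗ[K] A} (hφ : D.IsTwistingCharacter φ)
  (hπ : ∀ s, π' (UniversalEnvelopingAlgebra.ι K s) =
    π (UniversalEnvelopingAlgebra.ι K s) + φ (D.incl s))

include hπ in
lemma IsAction.twist (h : IsAction π M ρ) : IsAction π' M (LeviDatum.twist hφ ρ) where
  graded σ lam a ha m hm := by
    refine GrMod.apply_mem_gr_of_mem_UGr (fun b lam m hm => ?_) ha hm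
    have hρ := h.graded _ lam _ (gen_mem_UGr b) m hm
    rcases b with α | s
    · simpa only [LeviDatum.gen, Sum.elim_inl, LeviDatum.twist_e] using hρ
    · simp only [LeviDatum.gen, LeviDatum.genDeg, Sum.elim_inr, LeviDatum.twist_gToU,
        LinearMap.add_apply, Module.algebraMap_end_apply, zero_add] at hρ ⊢
      exact add_mem hρ (Submodule.smul_mem _ _ hm)
  weight lam μ hμ s m hm := by
    refine apply_eq_smul_of_adjoin_eq_top (ρ := (LeviDatum.twist hφ ρ).comp D.U0toU)
      (c := π'.comp (D.shift μ)) adjoin_range_ι ?_ s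
    rintro _ ⟨s, rfl⟩
    have hρ := h.weight lam μ hμ (UniversalEnvelopingAlgebra.ι K s) m hm
    rw [LeviDatum.U0toU_ι, LeviDatum.shift_ι, map_add] at hρ
    rw [AlgHom.comp_apply, AlgHom.comp_apply, LeviDatum.U0toU_ι, LeviDatum.shift_ι, map_add,
      LeviDatum.twist_gToU, LinearMap.add_apply, hρ, hπ, AlgHom.commutes, AlgHom.commutes,
      Module.algebraMap_end_apply, ← add_smul, add_right_comm]
  root α lam μ hμ m hm := by
    rw [LeviDatum.twist_e]
    exact h.root α lam μ hμ m hm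

/-- The functor `𝒞_{A,π} ⥤ 𝒞_{A,π'}` that twists the action of `U_χ` by `φ`, where `π'` is the sum
of `π` and `φ` on `𝔥`. -/
def twistFunctor : CObj.{u, v, w} D A π ⥤ CObj.{u, v, w} D A π' where
  obj M := ⟨M.base, LeviDatum.twist hφ M.ρ, M.isAction.twist hφ hπ⟩
  map f := ⟨f.toHom, LeviDatum.map_twist_apply hφ f.map_act⟩

/-- The isomorphism, given by the identity map, between two objects of `𝒞_A` with the same
underlying graded module and equal actions. -/
def CObj.isoOfActionEq {ρ' : D.Uχ →ₐ[K] Module.End A M.carrier} (h : IsAction π M ρ)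
    (h' : IsAction π M ρ') (e : ρ = ρ') : (⟨M, ρ, h⟩ : CObj D A π) ≅ ⟨M, ρ', h'⟩ where
  hom := ⟨𝟙 M, fun a m => LinearMap.congr_fun (AlgHom.congr_fun e a) m⟩
  inv := ⟨𝟙 M, fun a m => LinearMap.congr_fun (AlgHom.congr_fun e.symm a) m⟩

/-- Twisting by `φ` is an equivalence `𝒞_{A,π} ≌ 𝒞_{A,π'}`, with inverse the twist by `-φ`. -/
def twistEquivalence : CObj.{u, v, w} D A π ≌ CObj.{u, v, w} D A π' where
  functor := twistFunctor hφ hπ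
  inverse := twistFunctor hφ.neg fun s => by
    rw [hπ, LinearMap.neg_apply, add_neg_cancel_right]
  unitIso := NatIso.ofComponents fun M => CObj.isoOfActionEq M.isAction _
    (LeviDatum.twist_twist_of_add_eq_zero hφ hφ.neg (add_neg_cancel φ) M.ρ).symm
  counitIso := NatIso.ofComponents fun M => CObj.isoOfActionEq _ M.isAction
    (LeviDatum.twist_twist_of_add_eq_zero hφ.neg hφ (neg_add_cancel φ) M.ρ)

variable (D A) in
lemma piZero_ι (s : D.h) : piZero D A (UniversalEnvelopingAlgebra.ι K s) = 0 := by
  simp [piZero]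

end Action

end ReducedEnveloping

end

theorem mainTheorem8_general {K : Type u} [Field K] {p : ℕ} (D : ReducedEnveloping.LeviDatum K p)
    (A : Type v) [CommRing A] [Algebra K A] (π π' : D.U0 →ₐ[K] A)
    (hπ : ∀ α β : D.R, (β : D.X) = -(α : D.X) → ∀ s : D.h, D.incl s = ⁅D.e α, D.e β⁆ →
      π' (UniversalEnvelopingAlgebra.ι K s) = π (UniversalEnvelopingAlgebra.ι K s)) :
    ∃ Θ : ReducedEnveloping.CObj.{u, v, w} D A π ≌ ReducedEnveloping.CObj.{u, v, w} D A π',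
      Θ.functor ⋙ ReducedEnveloping.forgetAction π' = ReducedEnveloping.forgetAction π ∧
      ∀ M : ReducedEnveloping.CObj.{u, v, w} D A π,
        ∃ (ρ : D.Uχ →ₐ[K] Module.End A M.base.carrier)
          (hρ : ReducedEnveloping.IsAction π' M.base ρ),
          Θ.functor.obj M = ⟨M.base, ρ, hρ⟩ ∧
          (∀ α : D.R, ρ (D.gToU (D.e α)) = M.ρ (D.gToU (D.e α))) ∧
          (∀ lam μ, D.Admissible lam μ → ∀ s : D.U0,
            ∀ m ∈ M.base.wt lam (ReducedEnveloping.dchar μ),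
              ρ (D.U0toU s) m = π' (D.shift μ s) • m) := by
  let ψ : D.h →ₗ[K] A := (π'.toLinearMap - π.toLinearMap) ∘ₗ
    (UniversalEnvelopingAlgebra.ι K : D.h →ₗ⁅K⁆ D.U0).toLinearMap
  have hψ (s : D.h) : ψ s =
      π' (UniversalEnvelopingAlgebra.ι K s) - π (UniversalEnvelopingAlgebra.ι K s) := rfl
  have hφ : D.IsTwistingCharacter (D.extendByZero ψ) :=
    ⟨D.extendByZero_e ψ, D.extendByZero_lie fun α β hβ s hs => by
      rw [hψ, hπ α β hβ s hs, sub_self]⟩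
  have hπψ (s : D.h) : π' (UniversalEnvelopingAlgebra.ι K s) =
      π (UniversalEnvelopingAlgebra.ι K s) + D.extendByZero ψ (D.incl s) := by
    rw [D.extendByZero_incl, hψ, add_sub_cancel]
  refine ⟨ReducedEnveloping.twistEquivalence hφ hπψ, rfl, fun M => ?_⟩
  have hρ := M.isAction.twist hφ hπψ
  exact ⟨_, hρ, rfl, ReducedEnveloping.LeviDatum.twist_e hφ M.ρ, hρ.weight⟩

theorem mainTheorem8 {K : Type u} [Field K] [IsAlgClosed K] {p : ℕ} [Fact p.Prime]
    [CharP K p] (D : ReducedEnveloping.LeviDatum K p)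
    (A : Type v) [CommRing A] [Algebra K A] [IsNoetherianRing A]
    (π : D.U0 →ₐ[K] A)
    (hπ : ∀ α β : D.R, (β : D.X) = -(α : D.X) → ∀ s : D.h, D.incl s = ⁅D.e α, D.e β⁆ →
      π (UniversalEnvelopingAlgebra.ι K s) = 0) :
    ∃ Θ : ReducedEnveloping.CObj.{u, v, w} D A (ReducedEnveloping.piZero D A) ≌
        ReducedEnveloping.CObj.{u, v, w} D A π,
      Θ.functor ⋙ ReducedEnveloping.forgetAction π =
        ReducedEnveloping.forgetAction (ReducedEnveloping.piZero D A) ∧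
      ∀ M : ReducedEnveloping.CObj.{u, v, w} D A (ReducedEnveloping.piZero D A),
        ∃ (ρ : D.Uχ →ₐ[K] Module.End A M.base.carrier)
          (hρ : ReducedEnveloping.IsAction π M.base ρ),
          Θ.functor.obj M = ⟨M.base, ρ, hρ⟩ ∧
          (∀ α : D.R, ρ (D.gToU (D.e α)) = M.ρ (D.gToU (D.e α))) ∧
          (∀ lam μ, D.Admissible lam μ → ∀ s : D.U0, ∀ m ∈ M.base.wt lam (ReducedEnveloping.dchar μ),
            ρ (D.U0toU s) m = π (D.shift μ s) • m) :=
  mainTheorem8_general D A (ReducedEnveloping.piZero D A) π fun α β hβ s hs => by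
    rw [hπ α β hβ s hs, ReducedEnveloping.piZero_ι]
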